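/- For $x\in\mathbb R$ let $\|x\|=\min_{m\in\mathbb Z}|x-m|$, and for $N\in\mathbb N$ and $\alpha,\gamma\in\mathbb R$ let $$R_N(\alpha,\gamma)=\sum_{n=1}^N\frac1{\|n\alpha-\gamma\|}\in[0,\infty],\qquad \tfrac10:=\infty .$$ A Liouville number is a real number $x$ such that for every $k\in\mathbb N$ there are integers $a,b$ with $b>1$ and $0<|x-a/b|<b^{-k}$. Let $\alpha$ be irrational. Then $\alpha$ is not a Liouville number if and only if for every $\gamma\in\mathbb R$ there is a constant $c>0$ such that $$R_N(\alpha,\gamma)\ge c\,N\log N\quad\text{for all integers } N\ge 2. \tag{$*$}$$ Moreover: (i) if $\alpha$ is not a Liouville number, then $c>0$ can be chosen depending only on $\alpha$, so that $(*)$ holds for all $\gamma\in\mathbb R$ simultaneously; (ii) if $\alpha$ is a Liouville number, then there are a $\gamma\in\mathbb R$ with $\|n\alpha-\gamma\|>0$ for all integers $n\ge1$ and positive integers $N_1<N_2<\cdots$ such that $R_{N_i}(\alpha,\gamma)=o(N_i\log N_i)$ as $i\to\infty$. -/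

import Mathlib

/-- The distance `‖x‖` from a real number `x` to the nearest integer. -/
noncomputable def distNearestInt (x : ℝ) : ℝ := |x - (round x : ℝ)|

/-- The rounding formula is indeed the minimum of `|x - m|` over all integers `m`. -/
theorem distNearestInt_isLeast (x : ℝ) :
    IsLeast (Set.range fun m : ℤ => |x - (m : ℝ)|) (distNearestInt x) := by
  refine ⟨⟨round x, rfl⟩, ?_⟩
  rintro _ ⟨m, rfl⟩
  exact round_le x m

/-- `R_N(α, γ) = ∑_{n=1}^N 1 / ‖n α - γ‖`, as an element of `[0, ∞]`: a vanishing denominator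
contributes `∞` (in `ℝ≥0∞` one has `0⁻¹ = ∞`). -/
noncomputable def recipSum (N : ℕ) (α γ : ℝ) : ENNReal :=
  ∑ n ∈ Finset.Icc 1 N, (ENNReal.ofReal (distNearestInt ((n : ℝ) * α - γ)))⁻¹

/-- If no denominator vanishes, `recipSum` is the usual sum of real numbers. -/
theorem recipSum_eq_ofReal (N : ℕ) (α γ : ℝ)
    (h : ∀ n ∈ Finset.Icc 1 N, 0 < distNearestInt ((n : ℝ) * α - γ)) :
    recipSum N α γ =
      ENNReal.ofReal (∑ n ∈ Finset.Icc 1 N, 1 / distNearestInt ((n : ℝ) * α - γ)) := by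
  rw [ENNReal.ofReal_sum_of_nonneg fun n hn => (one_div_pos.mpr (h n hn)).le]
  refine Finset.sum_congr rfl fun n hn => ?_
  rw [one_div, ENNReal.ofReal_inv_of_pos (h n hn)]

/-! Both directions replace `α` by a fraction `p/q` in lowest terms. Over `q` consecutive `n`, the
points `np/q` run through all fractions with denominator `q` mod 1, so a block's reciprocal sum has
order `q log q` if `γ` is not too close to a fraction, and at least this order once `1/q` is added
to each distance. Dirichlet's theorem gives `q ≤ N` with error at most `1/(Nq)`, hence a sum `≫ N
log q` uniformly in `γ` (`ofReal_mul_log_den_le_recipSum`). If `α` is not Liouville, `q` is at least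
a fixed power of `N`, up to a constant factor, so `log q ≫ log N`. If `α` is Liouville, the
approximation stays good up to `N = q^(m+1)`. For `γ` with `‖qγ‖ > 1/4` the sum is `O(N log q) = O(N
log N / (m+1))` (`recipSum_le_ofReal_mul_harmonic`). Baire's theorem supplies one `γ` that serves
for infinitely many `q`. -/

theorem distNearestInt_le_abs_sub (x : ℝ) (m : ℤ) : distNearestInt x ≤ |x - m| :=
  round_le x m

theorem le_distNearestInt {a x : ℝ} (h : ∀ m : ℤ, a ≤ |x - m|) : a ≤ distNearestInt x :=
  h (round x)

theorem distNearestInt_nonneg (x : ℝ) : 0 ≤ distNearestInt x := abs_nonneg _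

theorem distNearestInt_le_add_abs_sub (x y : ℝ) :
    distNearestInt x ≤ distNearestInt y + |x - y| := by
  have h := distNearestInt_le_abs_sub x (round y)
  have h' : |x - round y| ≤ |x - y| + |y - round y| := abs_sub_le _ _ _
  unfold distNearestInt at *
  linarith

theorem distNearestInt_add_intCast (x : ℝ) (m : ℤ) :
    distNearestInt (x + m) = distNearestInt x := by
  unfold distNearestInt
  rw [round_add_intCast]
  push_cast
  congr 1
  ring

theorem distNearestInt_natCast_mul_le (n : ℕ) (x : ℝ) :
    distNearestInt (n * x) ≤ n * distNearestInt x := by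
  have h := distNearestInt_le_abs_sub (n * x) (n * round x)
  push_cast at h
  rwa [← mul_sub, abs_mul, Nat.abs_cast] at h

theorem continuous_distNearestInt : Continuous distNearestInt := by
  refine (LipschitzWith.of_le_add fun x y => ?_).continuous
  rw [Real.dist_eq]
  exact distNearestInt_le_add_abs_sub x y

/-! ### Periodic sums over complete residue systems -/

/-- The points `u + i v` with `v` invertible mod `q` form a complete residue system mod `q`. -/
theorem sum_range_periodic_eq_sum_zmod {R : Type*} [AddCommMonoid R] {q : ℕ} [NeZero q]
    {h : ℤ → R} (hh : Function.Periodic h q) (u v : ℤ) (hv : IsUnit (v : ZMod q)) :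
    ∑ i ∈ Finset.range q, h (u + i * v) = ∑ r : ZMod q, h r.val := by
  have key : ∀ m : ℤ, h m = h ((m : ZMod q).val : ℤ) := fun m => by
    rw [ZMod.val_intCast, Int.emod_def, mul_comm]
    exact (hh.sub_int_mul_eq (m / q)).symm
  obtain ⟨w, hw⟩ := hv
  refine Finset.sum_bij' (fun i _ => ((u + i * v : ℤ) : ZMod q))
    (fun r _ => ((r - u) * (w⁻¹ : (ZMod q)ˣ) : ZMod q).val) (by simp) ?_ ?_ ?_ ?_
  · intro r _
    exact Finset.mem_range.2 (ZMod.val_lt _)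
  · intro i hi
    push_cast
    rw [← hw, add_sub_cancel_left, Units.mul_inv_cancel_right, ZMod.val_natCast,
      Nat.mod_eq_of_lt (Finset.mem_range.1 hi)]
  · intro r _
    push_cast
    rw [ZMod.natCast_zmod_val, ← hw, Units.inv_mul_cancel_right]
    ring
  · intro i _
    exact key _

/-- Each of the `M` blocks of length `q` is a full residue system. The free offset `u` allows
residues to be listed starting next to `qγ`. -/
theorem sum_Icc_periodic_eq_mul {q : ℕ} [NeZero q] {h : ℤ → ENNReal}
    (hh : Function.Periodic h q) (p u : ℤ) (hp : IsUnit (p : ZMod q)) (M : ℕ) :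
    ∑ n ∈ Finset.Icc 1 (M * q), h (n * p) = M * ∑ i ∈ Finset.range q, h (u + i) := by
  have block : ∀ v : ℤ, ∑ i ∈ Finset.range q, h (v + i * p) =
      ∑ i ∈ Finset.range q, h (u + i) := fun v => by
    rw [sum_range_periodic_eq_sum_zmod hh v p hp,
      ← sum_range_periodic_eq_sum_zmod hh u 1 (by simp)]
    simp
  have shift : ∑ n ∈ Finset.Icc 1 (M * q), h (n * p) =
      ∑ n ∈ Finset.range (M * q), h (p + n * p) := by
    rw [Finset.range_eq_Ico, ← Finset.Ico_add_one_right_eq_Icc, Finset.sum_Ico_eq_sum_range,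
      Finset.range_eq_Ico, Nat.add_sub_cancel]
    refine Finset.sum_congr rfl fun n _ => congrArg h ?_
    push_cast
    ring
  rw [shift]
  clear shift
  induction M with
  | zero => simp
  | succ M ih =>
    rw [Nat.succ_mul, Finset.sum_range_add, ih, Nat.cast_succ, add_mul, one_mul,
      ← block (p + (M * q : ℕ) * p)]
    congr 1
    refine Finset.sum_congr rfl fun i _ => congrArg h ?_
    push_cast
    ring

theorem periodic_distNearestInt_div_sub {q : ℕ} (hq : q ≠ 0) (γ : ℝ) :
    Function.Periodic (fun m : ℤ => distNearestInt (m / q - γ)) q := fun m => by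
  have hq' : (q : ℝ) ≠ 0 := Nat.cast_ne_zero.2 hq
  have : (((m + q : ℤ) : ℝ) / q - γ) = (m / q - γ) + (1 : ℤ) := by
    push_cast
    field_simp
    ring
  simp only [this, distNearestInt_add_intCast]

theorem Rat.isUnit_num_zmod_den (r : ℚ) : IsUnit (r.num : ZMod r.den) := by
  rw [ZMod.coe_int_isUnit_iff_isCoprime, Int.isCoprime_iff_gcd_eq_one, Int.gcd_comm]
  exact r.reduced

theorem sum_range_one_div_eq_harmonic (q : ℕ) :
    ∑ i ∈ Finset.range q, 1 / ((i : ℝ) + 1) = harmonic q := by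
  simp [harmonic]

/-! ### Lower bound from one rational approximation -/

/-- If `r` approximates `α` within `1 / (N q)`, where `q` is its denominator, then the multiples
of `α` are as close to `γ` as a complete residue system divided by `q` is. -/
theorem ofReal_mul_log_den_le_recipSum {α γ : ℝ} {r : ℚ} {N : ℕ} (hden : r.den ≤ N)
    (hr : |α - r| ≤ 1 / (N * r.den)) :
    ENNReal.ofReal (N / 4 * Real.log ((r.den : ℝ) + 1)) ≤ recipSum N α γ := by
  set q := r.den with hqdef
  have hq0 : 0 < q := r.pos
  have : NeZero q := ⟨hq0.ne'⟩
  have hq : (0 : ℝ) < q := Nat.cast_pos.2 hq0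
  have hN : (0 : ℝ) < N := Nat.cast_pos.2 (hq0.trans_le hden)
  set M := N / q
  have hMN : M * q ≤ N := Nat.div_mul_le_self N q
  have hMN' : (N : ℝ) ≤ 2 * (M * q) := by
    have h1 : N < (M + 1) * q := by
      rw [← Nat.div_lt_iff_lt_mul hq0]
      exact Nat.lt_succ_self _
    have h2 : 1 ≤ M := (Nat.one_le_div_iff hq0).2 hden
    have h3 : N ≤ 2 * (M * q) := by nlinarith
    exact_mod_cast h3
  -- The summand `1/q` absorbs the error `n|α - r| ≤ N/(Nq)`.
  set h : ℤ → ENNReal := fun m => (ENNReal.ofReal (distNearestInt (m / q - γ) + 1 / q))⁻¹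
  have hper : Function.Periodic h q := fun m => by
    have := periodic_distNearestInt_div_sub hq0.ne' γ m
    simp only [h]
    simp only at this
    rw [this]
  have hterm : ∀ n ∈ Finset.Icc 1 (M * q),
      h (n * r.num) ≤ (ENNReal.ofReal (distNearestInt (n * α - γ)))⁻¹ := fun n hn => by
    refine ENNReal.inv_le_inv.2 (ENNReal.ofReal_le_ofReal ?_)
    refine (distNearestInt_le_add_abs_sub _ (((n * r.num : ℤ) : ℝ) / q - γ)).trans ?_
    have hn' : (n : ℝ) ≤ N := by exact_mod_cast (Finset.mem_Icc.1 hn).2.trans hMN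
    have e : (n * α - γ) - (((n * r.num : ℤ) : ℝ) / q - γ) = n * (α - r) := by
      conv_rhs => rw [Rat.cast_def]
      push_cast
      ring
    rw [e, abs_mul, Nat.abs_cast]
    gcongr
    calc n * |α - r| ≤ N * (1 / (N * q)) := by gcongr
      _ = 1 / q := by field_simp
  -- The `i`-th fraction counted from `⌊γq⌋/q` is within `(i+1)/q` of `γ`, and `i + 2 ≤ 2(i + 1)`.
  have hres : ∀ i ∈ Finset.range q,
      ENNReal.ofReal (q / 2 * (1 / ((i : ℝ) + 1))) ≤ h (⌊γ * q⌋ + i) := fun i _ => by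
    have hd : distNearestInt (((⌊γ * q⌋ + i : ℤ) : ℝ) / q - γ) ≤ (i + 1) / q := by
      refine (distNearestInt_le_abs_sub _ 0).trans ?_
      have e : (((⌊γ * q⌋ + i : ℤ) : ℝ) / q - γ) - (0 : ℤ) = (i - Int.fract (γ * q)) / q := by
        rw [Int.fract]
        push_cast
        field_simp
        ring
      rw [e, abs_div, abs_of_pos hq]
      gcongr
      have h0 := Int.fract_nonneg (γ * q)
      have h1 := Int.fract_lt_one (γ * q)
      have h2 : (0 : ℝ) ≤ i := i.cast_nonneg
      rw [abs_le]
      constructor <;> linarith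
    have hpos : 0 < distNearestInt (((⌊γ * q⌋ + i : ℤ) : ℝ) / q - γ) + 1 / q :=
      add_pos_of_nonneg_of_pos (distNearestInt_nonneg _) (by positivity)
    simp only [h]
    rw [← ENNReal.ofReal_inv_of_pos hpos]
    refine ENNReal.ofReal_le_ofReal ?_
    rw [le_inv_comm₀ (by positivity) hpos]
    refine (add_le_add_left hd _).trans ?_
    have h2 : (0 : ℝ) ≤ i := i.cast_nonneg
    rw [mul_one_div, div_div, inv_div, ← add_div]
    gcongr
    linarith
  calc ENNReal.ofReal (N / 4 * Real.log ((q : ℝ) + 1))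
      ≤ ENNReal.ofReal (M * (q / 2 * harmonic q)) := by
        refine ENNReal.ofReal_le_ofReal ?_
        have hl := log_add_one_le_harmonic q
        push_cast at hl
        have hl0 : 0 ≤ Real.log ((q : ℝ) + 1) := Real.log_nonneg (by linarith)
        calc N / 4 * Real.log ((q : ℝ) + 1) ≤ (2 * (M * q)) / 4 * harmonic q := by gcongr
          _ = M * (q / 2 * harmonic q) := by ring
    _ = M * ∑ i ∈ Finset.range q, ENNReal.ofReal (q / 2 * (1 / ((i : ℝ) + 1))) := by
        rw [ENNReal.ofReal_mul (by positivity), ENNReal.ofReal_natCast,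
          ← sum_range_one_div_eq_harmonic, Finset.mul_sum,
          ENNReal.ofReal_sum_of_nonneg fun i _ => by positivity]
    _ ≤ M * ∑ i ∈ Finset.range q, h (⌊γ * q⌋ + i) := by
        gcongr with i hi
        exact hres i hi
    _ = ∑ n ∈ Finset.Icc 1 (M * q), h (n * r.num) :=
        (sum_Icc_periodic_eq_mul hper _ _ r.isUnit_num_zmod_den M).symm
    _ ≤ ∑ n ∈ Finset.Icc 1 (M * q), (ENNReal.ofReal (distNearestInt (n * α - γ)))⁻¹ :=
        Finset.sum_le_sum hterm
    _ ≤ recipSum N α γ :=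
        Finset.sum_le_sum_of_subset (Finset.Icc_subset_Icc_right hMN)

/-! ### Upper bound from one rational approximation -/

/-- If `‖q γ‖ > 1 / 4`, then `γ` stays away from all fractions with denominator `q`. -/
theorem min_div_le_distNearestInt {γ : ℝ} {q i : ℕ} (hγ : 1 / 4 < distNearestInt (q * γ))
    (hi : i < q) :
    min ((i : ℝ) + 1) (q - i) / (4 * q) ≤
      distNearestInt (((⌊q * γ⌋ + 1 + i : ℤ) : ℝ) / q - γ) := by
  have hq : (0 : ℝ) < q := Nat.cast_pos.2 (by omega)
  have hi' : (i : ℝ) + 1 ≤ q := by exact_mod_cast hi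
  have hi0 : (0 : ℝ) ≤ i := i.cast_nonneg
  have h0 := Int.fract_nonneg (q * γ)
  have h1 := Int.fract_lt_one (q * γ)
  have hfl : (⌊q * γ⌋ : ℝ) = q * γ - Int.fract (q * γ) := by rw [Int.fract]; ring
  have h2 : 1 / 4 < Int.fract (q * γ) := by
    have := hγ.trans_le (distNearestInt_le_abs_sub _ ⌊q * γ⌋)
    rwa [hfl, sub_sub_cancel, abs_of_nonneg h0] at this
  have h3 : Int.fract (q * γ) < 3 / 4 := by
    have := hγ.trans_le (distNearestInt_le_abs_sub _ (⌊q * γ⌋ + 1))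
    push_cast at this
    rw [hfl, abs_of_nonpos (by linarith)] at this
    linarith
  refine le_distNearestInt fun m => ?_
  have e : ((⌊q * γ⌋ + 1 + i : ℤ) : ℝ) / q - γ - m =
      (i + 1 - Int.fract (q * γ) - q * m) / q := by
    push_cast
    rw [hfl]
    field_simp
    ring
  rw [e, abs_div, abs_of_pos hq, ← div_div]
  gcongr
  -- The fractional part of `qγ` lies in `(1/4, 3/4)`, and `t - 3/4 ≥ t/4` for `t ≥ 1`; here `t` is
  -- `i + 1` or `q - i`.
  rcases le_or_gt m 0 with hm | hm
  · have hm' : (m : ℝ) ≤ 0 := by exact_mod_cast hm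
    have : (q : ℝ) * m ≤ 0 := mul_nonpos_of_nonneg_of_nonpos hq.le hm'
    have := min_le_left ((i : ℝ) + 1) (q - i)
    exact le_trans (by linarith) (le_abs_self _)
  · have hm' : (1 : ℝ) ≤ m := by exact_mod_cast hm
    have : (q : ℝ) ≤ q * m := le_mul_of_one_le_right hq.le hm'
    have := min_le_right ((i : ℝ) + 1) (q - i)
    exact le_trans (by linarith) (neg_le_abs _)

/-- The fractions `np/q` are at least `1/(4q)` away from `γ`, while `nα` differs from `np/q` by at
most `1/(8q)`, so the replacement at most halves a distance. Fractions on either side of `γ`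
contribute one harmonic sum each. -/
theorem recipSum_le_ofReal_mul_harmonic {α γ : ℝ} {r : ℚ} {M : ℕ}
    (hγ : 1 / 4 < distNearestInt (r.den * γ))
    (hr : (M * r.den : ℝ) * |α - r| ≤ 1 / (8 * r.den)) :
    recipSum (M * r.den) α γ ≤ ENNReal.ofReal (16 * (M * r.den) * harmonic r.den) := by
  set q := r.den with hqdef
  have hq0 : 0 < q := r.pos
  have : NeZero q := ⟨hq0.ne'⟩
  have hq : (0 : ℝ) < q := Nat.cast_pos.2 hq0
  set h : ℤ → ENNReal := fun m => (ENNReal.ofReal (distNearestInt (m / q - γ) / 2))⁻¹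
  have hper : Function.Periodic h q := fun m => by
    have := periodic_distNearestInt_div_sub hq0.ne' γ m
    simp only [h]
    simp only at this
    rw [this]
  have hterm : ∀ n ∈ Finset.Icc 1 (M * q),
      (ENNReal.ofReal (distNearestInt (n * α - γ)))⁻¹ ≤ h (n * r.num) := fun n hn => by
    refine ENNReal.inv_le_inv.2 (ENNReal.ofReal_le_ofReal ?_)
    have hn' : (n : ℝ) ≤ M * q := by exact_mod_cast (Finset.mem_Icc.1 hn).2
    have h1 := distNearestInt_le_add_abs_sub (((n * r.num : ℤ) : ℝ) / q - γ) (n * α - γ)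
    have e : (((n * r.num : ℤ) : ℝ) / q - γ) - (n * α - γ) = n * (r - α) := by
      conv_rhs => rw [Rat.cast_def]
      push_cast
      ring
    rw [e, abs_mul, Nat.abs_cast, abs_sub_comm] at h1
    have h2 : n * |α - r| ≤ 1 / (8 * q) := le_trans (by gcongr) hr
    have h3 : 1 / (4 * q) ≤ distNearestInt (((n * r.num : ℤ) : ℝ) / q - γ) := by
      -- Multiplication by `-q` turns the difference into `qγ` plus an integer.
      have h4 := distNearestInt_natCast_mul_le q (-(((n * r.num : ℤ) : ℝ) / q - γ))
      have e1 : (q : ℝ) * -(((n * r.num : ℤ) : ℝ) / q - γ) = q * γ + (-(n * r.num) : ℤ) := by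
        push_cast
        field_simp
        ring
      rw [e1, distNearestInt_add_intCast] at h4
      have e2 : ∀ x, distNearestInt (-x) ≤ distNearestInt x := fun x => by
        have := distNearestInt_le_abs_sub (-x) (-round x)
        push_cast at this
        rwa [← neg_sub', abs_neg] at this
      have h5 := mul_le_mul_of_nonneg_left (e2 (((n * r.num : ℤ) : ℝ) / q - γ)) hq.le
      rw [div_le_iff₀ (by positivity)]
      linarith
    have e3 : 1 / (8 * (q : ℝ)) = 1 / (4 * q) / 2 := by
      field_simp
      norm_num
    linarith
  have hres : ∀ i ∈ Finset.range q,
      h (⌊q * γ⌋ + 1 + i) ≤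
        ENNReal.ofReal (8 * q * (1 / ((i : ℝ) + 1) + 1 / (q - i))) := fun i hi => by
    have hi' := Finset.mem_range.1 hi
    have hd := min_div_le_distNearestInt hγ hi'
    have hqi : (0 : ℝ) < q - i := sub_pos.2 (by exact_mod_cast hi')
    have hi0 : (0 : ℝ) < (i : ℝ) + 1 := by positivity
    have hmin : 0 < min ((i : ℝ) + 1) (q - i) := lt_min hi0 hqi
    have hpos : 0 < distNearestInt (((⌊q * γ⌋ + 1 + i : ℤ) : ℝ) / q - γ) / 2 :=
      half_pos (lt_of_lt_of_le (by positivity) hd)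
    simp only [h]
    rw [← ENNReal.ofReal_inv_of_pos hpos]
    refine ENNReal.ofReal_le_ofReal ?_
    calc (distNearestInt (((⌊q * γ⌋ + 1 + i : ℤ) : ℝ) / q - γ) / 2)⁻¹
        ≤ (min ((i : ℝ) + 1) (q - i) / (4 * q) / 2)⁻¹ := by gcongr
      _ = 8 * q * (1 / min ((i : ℝ) + 1) (q - i)) := by
        field_simp
        norm_num
      _ ≤ _ := by
        gcongr
        rcases min_choice ((i : ℝ) + 1) (q - i) with h | h <;> rw [h]
        · exact le_add_of_nonneg_right (by positivity)
        · exact le_add_of_nonneg_left (by positivity)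
  have hsum : ∑ i ∈ Finset.range q, 8 * (q : ℝ) * (1 / ((i : ℝ) + 1) + 1 / (q - i)) =
      16 * q * harmonic q := by
    have hrefl : ∑ i ∈ Finset.range q, 1 / ((q : ℝ) - i) = harmonic q := by
      rw [← sum_range_one_div_eq_harmonic, ← Finset.sum_range_reflect]
      refine Finset.sum_congr rfl fun i hi => ?_
      have hi' := Finset.mem_range.1 hi
      rw [Nat.cast_sub (by omega), Nat.cast_sub (by omega)]
      push_cast
      congr 1
      ring
    rw [← Finset.mul_sum, Finset.sum_add_distrib, hrefl, sum_range_one_div_eq_harmonic]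
    ring
  calc recipSum (M * q) α γ ≤ ∑ n ∈ Finset.Icc 1 (M * q), h (n * r.num) :=
        Finset.sum_le_sum hterm
    _ = M * ∑ i ∈ Finset.range q, h (⌊q * γ⌋ + 1 + i) :=
        sum_Icc_periodic_eq_mul hper _ _ r.isUnit_num_zmod_den M
    _ ≤ M * ∑ i ∈ Finset.range q,
          ENNReal.ofReal (8 * q * (1 / ((i : ℝ) + 1) + 1 / (q - i))) := by
        gcongr with i hi
        exact hres i hi
    _ = ENNReal.ofReal (16 * (M * q) * harmonic q) := by
        rw [← ENNReal.ofReal_sum_of_nonneg, hsum, ← ENNReal.ofReal_natCast,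
          ← ENNReal.ofReal_mul (by positivity)]
        · congr 1
          ring
        · intro i hi
          have : (0 : ℝ) < q - i := sub_pos.2 (by exact_mod_cast Finset.mem_range.1 hi)
          positivity

/-! ### Irrationals that are not Liouville -/

theorem exists_forall_mul_log_le_recipSum {α : ℝ} (hα : Irrational α) (hL : ¬ Liouville α) :
    ∃ c : ℝ, 0 < c ∧ ∀ γ : ℝ, ∀ N : ℕ, 2 ≤ N →
      ENNReal.ofReal (c * ((N : ℝ) * Real.log N)) ≤ recipSum N α γ := by
  obtain ⟨k, hk⟩ : ∃ k : ℕ, ∀ a b : ℤ, 1 < b → α ≠ a / b →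
      1 / (b : ℝ) ^ k ≤ |α - a / b| := by
    unfold Liouville at hL
    push Not at hL
    exact hL
  refine ⟨1 / (8 * (k + 1)), by positivity, fun γ N hN => ?_⟩
  have hN0 : (0 : ℝ) < N := Nat.cast_pos.2 (by omega)
  obtain ⟨r, hr, hden⟩ := α.exists_rat_abs_sub_le_and_den_le (n := N) (by omega)
  have hq : (1 : ℝ) ≤ r.den := by exact_mod_cast r.pos
  have hr' : |α - r| ≤ 1 / (N * r.den) := hr.trans (by gcongr; linarith)
  refine le_trans (ENNReal.ofReal_le_ofReal ?_) (ofReal_mul_log_den_le_recipSum hden hr')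
  -- Doubling numerator and denominator makes the denominator exceed 1 even when `r` is an integer.
  have hcast : ((2 * r.num : ℤ) : ℝ) / ((2 * r.den : ℤ) : ℝ) = r := by
    rw [Rat.cast_def]
    push_cast
    rw [mul_div_mul_left _ _ two_ne_zero]
  have h1 := hk (2 * r.num) (2 * r.den) (by have := r.pos; omega)
    (by rw [hcast]; exact hα.ne_rat r)
  rw [hcast] at h1
  push_cast at h1
  have h2 := h1.trans hr'
  rw [one_div_le_one_div (by positivity) (by positivity)] at h2
  -- Using `q + 1` and `k + 1` covers `q = 1` and `k = 0`; the exponent `2(k+1)` times 4 gives the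
  -- constant `1/(8(k+1))`.
  have h3 : (N : ℝ) ≤ ((r.den : ℝ) + 1) ^ (2 * (k + 1)) :=
    calc (N : ℝ) ≤ N * r.den := le_mul_of_one_le_right hN0.le hq
      _ ≤ (2 * r.den) ^ k := h2
      _ ≤ (2 * r.den) ^ (k + 1) := pow_le_pow_right₀ (by linarith) k.le_succ
      _ ≤ (((r.den : ℝ) + 1) ^ 2) ^ (k + 1) := by
        gcongr
        nlinarith
      _ = _ := by rw [← pow_mul]
  have h4 := Real.log_le_log hN0 h3
  rw [Real.log_pow] at h4
  push_cast at h4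
  calc 1 / (8 * ((k : ℝ) + 1)) * (N * Real.log N)
      ≤ 1 / (8 * ((k : ℝ) + 1)) * (N * (2 * (k + 1) * Real.log ((r.den : ℝ) + 1))) := by gcongr
    _ = N / 4 * Real.log ((r.den : ℝ) + 1) := by
      field_simp
      ring

/-! ### Liouville numbers -/

/-- Lowest terms are needed for `p` to be invertible mod `q`. Reduction only shrinks the
denominator, which keeps the bound; the denominator stays above `Q` because an irrational is bounded
away from fractions of bounded denominator. -/
theorem Liouville.exists_rat_den_gt {α : ℝ} (hL : Liouville α) (k Q : ℕ) :
    ∃ r : ℚ, Q < r.den ∧ |α - r| < 1 / (r.den : ℝ) ^ k := by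
  have hε : ∀ᶠ ε : ℝ in nhdsWithin 0 (Set.Ioi 0), ∀ r : ℚ, r.den ≤ Q → ε ≤ dist α r :=
    (hL.irrational.eventually_forall_le_dist_cast_rat_of_den_le Q).filter_mono nhdsWithin_le_nhds
  obtain ⟨ε, hε, hε0⟩ := (hε.and self_mem_nhdsWithin).exists
  have hε0 : 0 < ε := hε0
  obtain ⟨B, hB⟩ := exists_nat_gt (1 / ε)
  obtain ⟨b, hb, a, -, hab⟩ :=
    Filter.frequently_atTop.1 (hL.frequently_exists_num (k + 1)) (B + 1)
  have hb1 : (1 : ℝ) ≤ b := by exact_mod_cast (by omega : 1 ≤ b)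
  have hBb : (B : ℝ) ≤ b := by exact_mod_cast (by omega : B ≤ b)
  set r : ℚ := a / b with hrdef
  have hrc : ((r : ℚ) : ℝ) = a / b := by rw [hrdef]; push_cast; rfl
  have hden : r.den ≤ b := by
    have : (r.den : ℤ) ∣ b := by
      have := Rat.den_dvd a b
      rwa [Rat.divInt_eq_div, Int.cast_natCast] at this
    exact Nat.le_of_dvd (by omega) (by exact_mod_cast this)
  have hden' : (r.den : ℝ) ≤ b := by exact_mod_cast hden
  have hd0 : (0 : ℝ) < r.den := by exact_mod_cast r.pos
  rw [← hrc] at hab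
  refine ⟨r, ?_, hab.trans_le ?_⟩
  · by_contra! hle
    have h1 := hε r hle
    rw [Real.dist_eq] at h1
    have h2 : 1 / (b : ℝ) ^ (k + 1) ≤ 1 / b := by
      gcongr
      exact le_self_pow₀ hb1 (by omega)
    have h3 : 1 / (b : ℝ) < ε := by
      rw [div_lt_comm₀ (by linarith) hε0]
      linarith
    linarith
  · gcongr
    calc (r.den : ℝ) ^ k ≤ b ^ k := by gcongr
      _ ≤ b ^ (k + 1) := pow_le_pow_right₀ hb1 k.le_succ

/-- By Baire's theorem there is a `γ` that is badly placed with respect to infinitely many of the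
very good rational approximations to a Liouville number. -/
theorem Liouville.exists_forall_exists_rat {α : ℝ} (hL : Liouville α) :
    ∃ γ : ℝ, ∀ k : ℕ, ∃ r : ℚ, k < r.den ∧ |α - r| < 1 / (r.den : ℝ) ^ k ∧
      1 / 4 < distNearestInt (r.den * γ) := by
  set U : ℕ → Set ℝ := fun k => {γ | ∃ r : ℚ, k < r.den ∧ |α - r| < 1 / (r.den : ℝ) ^ k ∧
    1 / 4 < distNearestInt (r.den * γ)}
  have hopen : ∀ k, IsOpen (U k) := fun k => by
    have : U k = ⋃ r : ℚ, ⋃ (_ : k < r.den ∧ |α - r| < 1 / (r.den : ℝ) ^ k),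
        {γ : ℝ | 1 / 4 < distNearestInt (r.den * γ)} := by
      ext γ
      simp [U, and_assoc]
    rw [this]
    refine isOpen_iUnion fun r => isOpen_iUnion fun _ => isOpen_lt continuous_const ?_
    exact continuous_distNearestInt.comp (continuous_const.mul continuous_id)
  have hdense : ∀ k, Dense (U k) := fun k => by
    refine Metric.dense_iff.2 fun x ε hε => ?_
    obtain ⟨B, hB⟩ := exists_nat_gt (1 / ε)
    obtain ⟨r, hr, hr'⟩ := hL.exists_rat_den_gt k (k + B)
    have hq : (0 : ℝ) < r.den := by exact_mod_cast r.pos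
    have hBq : (B : ℝ) ≤ r.den := by exact_mod_cast (by omega : B ≤ r.den)
    -- Midpoints between neighbouring fractions have `‖qγ‖ = 1/2`, and one lies within `1/(2q)` of
    -- `x`.
    refine ⟨(⌊r.den * x⌋ + 1 / 2) / r.den, ?_, r, by omega, hr', ?_⟩
    · have e : ((⌊r.den * x⌋ : ℝ) + 1 / 2) / r.den - x =
          (1 / 2 - Int.fract (r.den * x)) / r.den := by
        rw [Int.fract]
        field_simp
        ring
      rw [Metric.mem_ball, Real.dist_eq, e, abs_div, abs_of_pos hq, div_lt_iff₀ hq]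
      have h1 : 1 < ε * r.den := by
        rw [div_lt_iff₀ hε] at hB
        nlinarith
      have h2 := Int.fract_nonneg (r.den * x)
      have h3 := Int.fract_lt_one (r.den * x)
      rw [abs_lt]
      constructor <;> linarith
    · rw [mul_div_cancel₀ _ hq.ne', add_comm, distNearestInt_add_intCast]
      refine lt_of_lt_of_le (by norm_num : (1 / 4 : ℝ) < 1 / 2) (le_distNearestInt fun m => ?_)
      rcases le_or_gt m 0 with hm | hm
      · have hm' : (m : ℝ) ≤ 0 := by exact_mod_cast hm
        exact le_trans (by linarith) (le_abs_self _)
      · have hm' : (1 : ℝ) ≤ m := by exact_mod_cast hm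
        exact le_trans (by linarith) (neg_le_abs _)
  obtain ⟨γ, hγ⟩ := (dense_iInter_of_isOpen_nat hopen hdense).nonempty
  exact ⟨γ, fun k => Set.mem_iInter.1 hγ k⟩

theorem Liouville.exists_recipSum_le {α : ℝ} (hL : Liouville α) :
    ∃ γ : ℝ, (∀ n : ℕ, 0 < distNearestInt ((n : ℝ) * α - γ)) ∧
      ∃ M : ℕ → ℕ, StrictMono M ∧ ∀ m : ℕ,
        recipSum (M m) α γ ≤
          ENNReal.ofReal (32 / ((m : ℝ) + 1) * ((M m : ℝ) * Real.log (M m))) := by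
  obtain ⟨γ, hγ⟩ := hL.exists_forall_exists_rat
  refine ⟨γ, fun n => (distNearestInt_nonneg _).lt_of_ne' fun h0 => ?_,
    Filter.extraction_forall_of_frequently (P := fun m N => recipSum N α γ ≤
      ENNReal.ofReal (32 / ((m : ℝ) + 1) * ((N : ℝ) * Real.log N))) fun m =>
        Filter.frequently_atTop.2 fun L => ?_⟩
  -- If `nα - γ` were an integer, `qγ` would be within `qn|α - r| ≤ n/q ≤ 1/4` of an integer; the
  -- index ensures `q ≥ 4n` and exponent at least 2.
  · obtain ⟨r, hrk, hr, hrγ⟩ := hγ (4 * n + 2)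
    have hq1 : (1 : ℝ) ≤ r.den := by exact_mod_cast r.pos
    have hq : (0 : ℝ) < r.den := by linarith
    have h4 : 4 * (n : ℝ) ≤ r.den := by exact_mod_cast (by omega : 4 * n ≤ r.den)
    have h1 := distNearestInt_le_abs_sub (r.den * γ) (n * r.num - r.den * round (n * α - γ))
    have h2 : (n : ℝ) * α - γ = round (n * α - γ) := sub_eq_zero.1 (abs_eq_zero.1 h0)
    have e : (r.den : ℝ) * γ - ((n * r.num - r.den * round (n * α - γ) : ℤ) : ℝ) =
        r.den * n * (α - r) := by
      push_cast
      rw [← h2]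
      conv_rhs => rw [Rat.cast_def]
      field_simp
      ring
    rw [e, abs_mul, abs_of_nonneg (by positivity)] at h1
    have h3 : |α - r| ≤ 1 / (r.den : ℝ) ^ 2 :=
      hr.le.trans (one_div_le_one_div_of_le (by positivity) (pow_le_pow_right₀ hq1 (by omega)))
    have h5 : r.den * n * |α - r| ≤ 1 / 4 :=
      calc r.den * n * |α - r| ≤ r.den * n * (1 / (r.den : ℝ) ^ 2) := by gcongr
        _ = n / r.den := by field_simp
        _ ≤ 1 / 4 := by
          rw [div_le_iff₀ hq]
          linarith
    linarith
  -- This gives exponent at least `m + 3`, `q > L`, and `q ≥ 8`; the last yields `1/q² ≤ 1/(8q)` and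
  -- `1 + log q ≤ 2 log q`.
  · obtain ⟨r, hrk, hr, hrγ⟩ := hγ (m + L + 8)
    have hq8 : (8 : ℝ) ≤ r.den := by exact_mod_cast (by omega : 8 ≤ r.den)
    have hq : (0 : ℝ) < r.den := by linarith
    refine ⟨r.den ^ m * r.den, ?_, ?_⟩
    · have := Nat.le_mul_of_pos_left r.den (Nat.pow_pos (n := m) r.pos)
      omega
    · refine (recipSum_le_ofReal_mul_harmonic hrγ ?_).trans (ENNReal.ofReal_le_ofReal ?_)
      · push_cast
        have h3 : |α - r| ≤ 1 / (r.den : ℝ) ^ (m + 3) :=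
          hr.le.trans (one_div_le_one_div_of_le (by positivity)
            (pow_le_pow_right₀ (by linarith) (by omega)))
        calc (r.den : ℝ) ^ m * r.den * |α - r|
            ≤ (r.den : ℝ) ^ m * r.den * (1 / (r.den : ℝ) ^ (m + 3)) := by gcongr
          _ = 1 / (r.den * r.den) := by
            rw [pow_add]
            field_simp
          _ ≤ 1 / (8 * r.den) := by gcongr
      · have h1 := harmonic_le_one_add_log r.den
        have h2 : 1 ≤ Real.log r.den := by
          rw [Real.le_log_iff_exp_le hq]
          linarith [Real.exp_one_lt_d9]
        push_cast
        rw [← pow_succ, Real.log_pow]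
        push_cast
        calc 16 * (r.den : ℝ) ^ (m + 1) * harmonic r.den
            ≤ 16 * (r.den : ℝ) ^ (m + 1) * (2 * Real.log r.den) := by
              gcongr
              linarith
          _ = _ := by
            field_simp
            norm_num

theorem theorem1p8 (α : ℝ) (hα : Irrational α) :
    (¬ Liouville α ↔
      ∀ γ : ℝ, ∃ c : ℝ, 0 < c ∧ ∀ N : ℕ, 2 ≤ N →
        ENNReal.ofReal (c * ((N : ℝ) * Real.log N)) ≤ recipSum N α γ) ∧
    (¬ Liouville α →
      ∃ c : ℝ, 0 < c ∧ ∀ γ : ℝ, ∀ N : ℕ, 2 ≤ N →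
        ENNReal.ofReal (c * ((N : ℝ) * Real.log N)) ≤ recipSum N α γ) ∧
    (Liouville α →
      ∃ γ : ℝ, (∀ n : ℕ, 1 ≤ n → 0 < distNearestInt ((n : ℝ) * α - γ)) ∧
        ∃ M : ℕ → ℕ, StrictMono M ∧
          ∀ ε : ℝ, 0 < ε → ∀ᶠ i in Filter.atTop,
            recipSum (M i) α γ ≤ ENNReal.ofReal (ε * ((M i : ℝ) * Real.log (M i)))) := by
  have upper : Liouville α →
      ∃ γ : ℝ, (∀ n : ℕ, 1 ≤ n → 0 < distNearestInt ((n : ℝ) * α - γ)) ∧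
        ∃ M : ℕ → ℕ, StrictMono M ∧
          ∀ ε : ℝ, 0 < ε → ∀ᶠ i in Filter.atTop,
            recipSum (M i) α γ ≤ ENNReal.ofReal (ε * ((M i : ℝ) * Real.log (M i))) := by
    intro hL
    obtain ⟨γ, hpos, M, hM, hle⟩ := hL.exists_recipSum_le
    refine ⟨γ, fun n _ => hpos n, M, hM, fun ε hε => ?_⟩
    obtain ⟨B, hB⟩ := exists_nat_gt (32 / ε)
    filter_upwards [Filter.eventually_ge_atTop B] with i hi
    refine (hle i).trans (ENNReal.ofReal_le_ofReal ?_)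
    have hi' : (B : ℝ) ≤ i := by exact_mod_cast hi
    have hlog : 0 ≤ Real.log (M i) := Real.log_natCast_nonneg _
    gcongr
    rw [div_le_comm₀ (by positivity) hε]
    linarith
  refine ⟨⟨fun hL γ => ?_, fun h hL => ?_⟩, exists_forall_mul_log_le_recipSum hα, upper⟩
  · obtain ⟨c, hc, h⟩ := exists_forall_mul_log_le_recipSum hα hL
    exact ⟨c, hc, h γ⟩
  · obtain ⟨γ, -, M, hM, hle⟩ := upper hL
    obtain ⟨c, hc, hge⟩ := h γ
    -- Taking `i ≥ 2` forces `M i ≥ 2`, so `N log N > 0` and the bounds with `c` and `c/2` conflict.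
    obtain ⟨i, hi, hi2⟩ :=
      ((hle (c / 2) (half_pos hc)).and (Filter.eventually_ge_atTop 2)).exists
    have hMi : 2 ≤ M i := hi2.trans (hM.id_le i)
    have hMi' : (1 : ℝ) < M i := by exact_mod_cast hMi
    have hpos : 0 < (M i : ℝ) * Real.log (M i) :=
      mul_pos (by linarith) (Real.log_pos hMi')
    have hcmp := (ENNReal.ofReal_le_ofReal_iff (by positivity)).1 ((hge _ hMi).trans hi)
    nlinarith
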